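/- Let $\xi$ be a random variable with $S$ scenarios $\xi^s=(\xi^s_1,\dots,\xi^s_{T-1})$ of probabilities $p_s$, $\sum_s p_s=1$. Write $x\in\mathbb{R}^{S\times n}$, $n=n_1+\dots+n_T$, as $x=(x^s_t)$ with $x^s_t\in\mathbb{R}^{n_t}$ the decision at stage $t$ under scenario $s$, and $x^s=(x^s_1,\dots,x^s_T)\in\mathbb{R}^n$. Let $$\mathcal{B}^s_t=\{\sigma:\ \xi^\sigma_\tau=\xi^s_\tau\ \text{for all}\ \tau\le t-1\},\qquad \mathcal{W}=\{x\in\mathbb{R}^{S\times n}:\ x^{s}_t=x^{\sigma}_t\ \text{for all}\ s,t\ \text{and all}\ \sigma\in\mathcal{B}^{s}_t\},$$ and consider the problem $$\min_{x\in\mathcal{W}}\ \sum_{s=1}^S p_s f^s(x^s),\qquad f^s:\mathbb{R}^n\to(-\infty,+\infty].\tag{P}$$ Assume that $p_s>0$ for all $s$; that the functions $f^s$ are convex, proper and lower semicontinuous; that (P) has a solution; and that $\mathcal{W}$ intersects the relative interior of the domain $\{x:\sum_s p_sf^s(x^s)<+\infty\}$ of the objective. Let $\mu>0$, let $q_s>0$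 for $s=1,\dots,S$, $\sum_s q_s=1$, and let $z^0\in\mathcal{W}$. For $z\in\mathbb{R}^{S\times n}$ let $\Pi z$ be defined by $$(\Pi z)^s_t=\frac{1}{\sum_{\sigma\in\mathcal{B}^s_t}p_\sigma}\sum_{\sigma\in\mathcal{B}^s_t}p_\sigma z^\sigma_t .$$ Randomized Progressive Hedging is the following iteration. For $k=0,1,\dots$, draw a scenario $s^k$, independently of the other draws, with $\mathbb{P}[s^k=s]=q_s$; compute only the row $x^{k+1,s^k}=(\Pi z^k)^{s^k}$; solve the subproblem $$y^{k+1,s^k}=\operatorname*{argmin}_{y\in\mathbb{R}^n}\Big\{f^{s^k}(y)+\frac1{2\mu}\big\|y-2x^{k+1,s^k}+z^{k,s^k}\big\|^2\Big\};$$ and set $z^{k+1,s^k}=z^{k,s^k}+y^{k+1,s^k}-x^{k+1,s^k}$ and $z^{k+1,s}=z^{k,s}$ for $s\ne s^k$. The output sequence is $\tilde x^k=\Pi z^k$. Then the algorithm is well defined (every such subproblem has exactly one minimizer); almost surely $\tilde x^k\in\mathcal{W}$ for all $k$; and almost surely $(\tilde x^k)$ converges to a solution of (P). -/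

import Mathlib

open MeasureTheory ProbabilityTheory Filter Topology

noncomputable section

/-- A decision along one scenario: an element of `ℝ^{n_1} × ⋯ × ℝ^{n_T} = ℝ^n`, with the Euclidean
norm. Stages are numbered `0, …, T - 1`. -/
abbrev Decision {T : ℕ} (n : Fin T → ℕ) : Type :=
  PiLp 2 (fun t : Fin T => EuclideanSpace ℝ (Fin (n t)))

/-- A full variable `x ∈ ℝ^{S × n}`: one decision per scenario. -/
abbrev FullVar (S : ℕ) {T : ℕ} (n : Fin T → ℕ) : Type :=
  Fin S → Decision n

/-- Convexity of an extended-real-valued function: its epigraph is convex. -/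
def ConvexEReal {E : Type*} [AddCommGroup E] [Module ℝ E] (f : E → EReal) : Prop :=
  Convex ℝ {q : E × ℝ | f q.1 ≤ (q.2 : EReal)}

/-- Properness: the value `-∞` is never taken, and some value is not `+∞`. -/
def ProperEReal {E : Type*} (f : E → EReal) : Prop :=
  (∀ x, f x ≠ ⊥) ∧ ∃ x, f x ≠ ⊤

/-- A minimizer of `g` over the whole space (meaningful when there is one). -/
def argmin {E : Type*} [Nonempty E] (g : E → EReal) : E :=
  Classical.epsilon (fun y => IsMinOn g Set.univ y)

/-- The data of a multistage stochastic program with `S` scenarios and `T` stages: the values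
`ξ^s = (ξ^s_1, …, ξ^s_{T-1})`, the probabilities `p_s`, and the costs `f^s`. -/
structure MultistageProblem (S T : ℕ) (n : Fin T → ℕ) (Ξ : Fin (T - 1) → Type*) where
  scen : Fin S → (τ : Fin (T - 1)) → Ξ τ
  prob : Fin S → ℝ
  prob_sum : ∑ s, prob s = 1
  cost : Fin S → Decision n → EReal

namespace MultistageProblem

variable {S T : ℕ} {n : Fin T → ℕ} {Ξ : Fin (T - 1) → Type*}

/-- Two scenarios have the same history when the decision of stage `t` is taken. With stages and
observations both numbered from `0`, the observations made before stage `t` are those with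
index `< t`, so that at the first stage the condition is void. -/
def SameHistory (M : MultistageProblem S T n Ξ) (t : Fin T) (s₁ s₂ : Fin S) : Prop :=
  ∀ τ : Fin (T - 1), (τ : ℕ) < (t : ℕ) → M.scen s₁ τ = M.scen s₂ τ

/-- The non-anticipativity subspace `𝓦` of `ℝ^{S × n}`. -/
def nonanticipative (M : MultistageProblem S T n Ξ) : Submodule ℝ (FullVar S n) where
  carrier := {x | ∀ (t : Fin T) (s₁ s₂ : Fin S), M.SameHistory t s₁ s₂ → x s₁ t = x s₂ t}
  add_mem' := by
    intro a b ha hb t s₁ s₂ h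
    simp [ha t s₁ s₂ h, hb t s₁ s₂ h]
  zero_mem' := by
    intro t s₁ s₂ _
    rfl
  smul_mem' := by
    intro c a ha t s₁ s₂ h
    simp [ha t s₁ s₂ h]

/-- The objective `∑ s, p_s f^s(x^s)`. -/
def objective (M : MultistageProblem S T n Ξ) (x : FullVar S n) : EReal :=
  ∑ s, (M.prob s : EReal) * M.cost s (x s)

/-- The domain of the objective. -/
def domain (M : MultistageProblem S T n Ξ) : Set (FullVar S n) :=
  {x | M.objective x < ⊤}

/-- `x` solves the problem of minimizing the objective over `𝓦`. -/
def IsSolution (M : MultistageProblem S T n Ξ) (x : FullVar S n) : Prop :=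
  x ∈ M.nonanticipative ∧ IsMinOn M.objective (M.nonanticipative : Set (FullVar S n)) x

open Classical in
/-- The bundle of the scenarios that cannot be distinguished from `s` at stage `t`. -/
def bundle (M : MultistageProblem S T n Ξ) (s : Fin S) (t : Fin T) : Finset (Fin S) :=
  Finset.univ.filter (fun σ => M.SameHistory t s σ)

/-- The probability-weighted average of `z` over the bundles of scenario `s`, stage by stage. -/
def bundleAvg (M : MultistageProblem S T n Ξ) (z : FullVar S n) (s : Fin S) : Decision n :=
  WithLp.toLp 2 (fun t =>
    (∑ σ ∈ M.bundle s t, M.prob σ)⁻¹ • ∑ σ ∈ M.bundle s t, M.prob σ • z σ t)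

/-- The objective of the proximal subproblem of scenario `s`:
`y ↦ f^s(y) + (1 / (2 μ)) ‖y - 2 x^s + z^s‖²` with `x^s` the bundle average of `z`. -/
def subproblem (M : MultistageProblem S T n Ξ) (mu : ℝ) (z : FullVar S n) (s : Fin S)
    (y : Decision n) : EReal :=
  M.cost s y + ((1 / (2 * mu) * ‖y - (2 : ℝ) • M.bundleAvg z s + z s‖ ^ 2 : ℝ) : EReal)

/-- One iteration of Randomized Progressive Hedging, from `z`, with the scenario `s` drawn. -/
def rphStep (M : MultistageProblem S T n Ξ) (mu : ℝ) (z : FullVar S n) (s : Fin S) :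
    FullVar S n :=
  Function.update z s (z s + argmin (M.subproblem mu z s) - M.bundleAvg z s)

/-- The iterate `z^k` of Randomized Progressive Hedging when scenario `draw k` is drawn at
iteration `k`. -/
def rphIterate (M : MultistageProblem S T n Ξ) (mu : ℝ) (z₀ : FullVar S n) (draw : ℕ → Fin S) :
    ℕ → FullVar S n
  | 0 => z₀
  | k + 1 => M.rphStep mu (rphIterate M mu z₀ draw k) (draw k)

/-- The output `x̃^k` of Randomized Progressive Hedging. -/
def rphOutput (M : MultistageProblem S T n Ξ) (mu : ℝ) (z₀ : FullVar S n) (draw : ℕ → Fin S)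
    (k : ℕ) : FullVar S n :=
  fun s => M.bundleAvg (M.rphIterate mu z₀ draw k) s

end MultistageProblem

end

/-! For the inner product weighted by the `prob s`, `bundleAvg` is the orthogonal projection Π onto
the nonanticipative subspace, and a step of the algorithm updates one random row of the
Douglas–Rachford operator Tz = z + prox(2Πz - z) - Πz.

If Tz = z, then (Πz - z)/μ is a row-wise subgradient at Πz orthogonal to the subspace, so Πz is
optimal (`isSolution_bundleAvg_of_isFixedPt`). Conversely a solution x with a multiplier u gives the
fixed point x - μu (`exists_isFixedPt`). The multiplier comes from Fenchel duality, which is where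
the relative interior condition enters (`exists_linearMap_of_forall_le`).

T is firmly nonexpansive: the squared distance to a fixed point drops by at least the squared
residual of Tz - z (`douglasRachford_descent`). Weighting row s by p_s/q_s cancels the probability
of drawing it, so one random step achieves the same drop in conditional expectation
(`sum_weightedSqDist_rphStep_le`). Supermartingale convergence (`ae_tendsto_of_recursion`) then
makes the distance to each given fixed point converge and the residual vanish, almost surely. A
countable dense set of fixed points yields one null set for all of them, Opial's argument gives
convergence of z^k to a fixed point, and continuity of Π carries this to the output. -/

noncomputable section

open scoped InnerProductSpace

/-! ### Proximal points of extended-real-valued convex functions -/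

section Subgradient

lemma EReal.exists_coe_eq {a : EReal} (h : a ≠ ⊥) (h' : a ≠ ⊤) : ∃ r : ℝ, a = r :=
  ⟨a.toReal, (EReal.coe_toReal h' h).symm⟩

/-- The objective of the proximal problem of `f` with parameter `mu` at `c`. -/
def proxObjective {E : Type*} [NormedAddCommGroup E] (f : E → EReal) (mu : ℝ) (c y : E) : EReal :=
  f y + ((1 / (2 * mu) * ‖y - c‖ ^ 2 : ℝ) : EReal)

lemma proxObjective_of_eq {E : Type*} [NormedAddCommGroup E] {f : E → EReal} {mu : ℝ} {c y : E} {r : ℝ} (h : f y = r) :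
    proxObjective f mu c y = ((r + 1 / (2 * mu) * ‖y - c‖ ^ 2 : ℝ) : EReal) := by
  rw [proxObjective, h, EReal.coe_add]

variable {E : Type*} [NormedAddCommGroup E] [InnerProductSpace ℝ E]

/-- `u` is a subgradient of `f` at `y`, where `f` is finite. -/
def IsSubgradientAt (f : E → EReal) (u y : E) : Prop :=
  ∃ r : ℝ, f y = r ∧ ∀ (w : E) (ρ : ℝ), f w ≤ ρ → r + ⟪u, w - y⟫_ℝ ≤ ρ

lemma IsSubgradientAt.inner_sub_nonneg {f : E → EReal} {u u' y y' : E}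
    (h : IsSubgradientAt f u y) (h' : IsSubgradientAt f u' y') :
    0 ≤ ⟪u - u', y - y'⟫_ℝ := by
  obtain ⟨r, hr, H⟩ := h
  obtain ⟨r', hr', H'⟩ := h'
  have h1 := H y' r' hr'.le
  have h2 := H' y r hr.le
  have h3 : ⟪u, y' - y⟫_ℝ = - ⟪u, y - y'⟫_ℝ := by rw [← inner_neg_right, neg_sub]
  rw [inner_sub_left]
  linarith

lemma ConvexEReal.le_of_le {f : E → EReal} (hf : ConvexEReal f) {x y : E} {a b t : ℝ}
    (hx : f x ≤ a) (hy : f y ≤ b) (ht0 : 0 ≤ t) (ht1 : t ≤ 1) :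
    f (x + t • (y - x)) ≤ ((a + t * (b - a) : ℝ) : EReal) := by
  have h := hf (x := (x, a)) hx (y := (y, b)) hy (sub_nonneg.2 ht1) ht0 (by ring)
  simp only [Set.mem_ofPred_eq, Prod.smul_mk, Prod.mk_add_mk, smul_eq_mul] at h
  convert h using 2
  · module
  · ring_nf

lemma norm_add_smul_sq (a b : E) (t : ℝ) :
    ‖a + t • b‖ ^ 2 = ‖a‖ ^ 2 + 2 * t * ⟪a, b⟫_ℝ + t ^ 2 * ‖b‖ ^ 2 := by
  rw [norm_add_sq_real, inner_smul_right, norm_smul, mul_pow, Real.norm_eq_abs, sq_abs]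
  ring

/-- Expanding the square around `y`, the cross term is exactly what the subgradient inequality
absorbs. The quadratic gap left over yields both minimality and uniqueness of the proximal point. -/
lemma IsSubgradientAt.proxObjective_add_le {f : E → EReal} {mu : ℝ} (hmu : 0 < mu) {c y w : E}
    (h : IsSubgradientAt f (mu⁻¹ • (c - y)) y) {ρ : ℝ} (hw : f w = ρ) :
    proxObjective f mu c y + ((1 / (2 * mu) * ‖w - y‖ ^ 2 : ℝ) : EReal) ≤
      proxObjective f mu c w := by
  obtain ⟨r, hr, H⟩ := h
  rw [proxObjective_of_eq hr, proxObjective_of_eq hw, ← EReal.coe_add, EReal.coe_le_coe_iff]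
  have h1 := H w ρ hw.le
  have h2 : ‖w - c‖ ^ 2 = ‖y - c‖ ^ 2 - 2 * ⟪c - y, w - y⟫_ℝ + ‖w - y‖ ^ 2 := by
    have : w - c = -(c - y) + (1 : ℝ) • (w - y) := by module
    rw [this, norm_add_smul_sq, norm_neg, inner_neg_left, norm_sub_rev c y]
    ring
  rw [real_inner_smul_left] at h1
  rw [h2]
  have h3 : 1 / (2 * mu) * (‖y - c‖ ^ 2 - 2 * ⟪c - y, w - y⟫_ℝ + ‖w - y‖ ^ 2) =
      1 / (2 * mu) * ‖y - c‖ ^ 2 - mu⁻¹ * ⟪c - y, w - y⟫_ℝ + 1 / (2 * mu) * ‖w - y‖ ^ 2 := by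
    field_simp
  rw [h3]
  linarith

lemma IsSubgradientAt.isMinOn_proxObjective {f : E → EReal} (hf : ∀ x, f x ≠ ⊥)
    {mu : ℝ} (hmu : 0 < mu) {c y : E} (h : IsSubgradientAt f (mu⁻¹ • (c - y)) y) :
    IsMinOn (proxObjective f mu c) Set.univ y := by
  intro w _
  rw [Set.mem_ofPred_eq]
  by_cases hw : f w = ⊤
  · rw [proxObjective, proxObjective, hw, EReal.top_add_coe]
    exact le_top
  · obtain ⟨ρ, hρ⟩ := EReal.exists_coe_eq (hf w) hw
    refine le_trans ?_ (h.proxObjective_add_le hmu hρ)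
    exact le_add_of_nonneg_right (EReal.coe_nonneg.2 (by positivity))

/-- Compare `y` with `y + t • (w - y)`, bound `f` there by convexity, divide by `t` and let `t`
decrease to 0: the quadratic term in `w - y` disappears. No sum rule for subdifferentials is needed.
-/
lemma isSubgradientAt_of_isMinOn {f : E → EReal} (hconv : ConvexEReal f) (hf : ProperEReal f)
    {mu : ℝ} (hmu : 0 < mu) {c y : E} (h : IsMinOn (proxObjective f mu c) Set.univ y) :
    IsSubgradientAt f (mu⁻¹ • (c - y)) y := by
  have hy : f y ≠ ⊤ := by
    intro hy
    obtain ⟨x, hx⟩ := hf.2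
    obtain ⟨r, hr⟩ := EReal.exists_coe_eq (hf.1 x) hx
    have h1 := h (Set.mem_univ x)
    rw [Set.mem_ofPred_eq, proxObjective_of_eq hr, proxObjective, hy,
      EReal.top_add_coe] at h1
    exact EReal.coe_ne_top _ (top_le_iff.1 h1)
  obtain ⟨r, hr⟩ := EReal.exists_coe_eq (hf.1 y) hy
  refine ⟨r, hr, fun w ρ hw => ?_⟩
  have key : ∀ t : ℝ, 0 < t → t ≤ 1 →
      0 ≤ (ρ - r) - mu⁻¹ * ⟪c - y, w - y⟫_ℝ + t * (1 / (2 * mu) * ‖w - y‖ ^ 2) := by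
    intro t ht0 ht1
    have h1 := h (Set.mem_univ (y + t • (w - y)))
    have h2 := hconv.le_of_le hr.le hw ht0.le ht1
    rw [Set.mem_ofPred_eq, proxObjective_of_eq hr] at h1
    have h3 := h1.trans (add_le_add_left h2 _)
    rw [← EReal.coe_add, EReal.coe_le_coe_iff] at h3
    have h4 : y + t • (w - y) - c = -(c - y) + t • (w - y) := by module
    rw [h4, norm_add_smul_sq, norm_neg, inner_neg_left, norm_sub_rev c y] at h3
    have h5 : 1 / (2 * mu) * (‖y - c‖ ^ 2 + 2 * t * -⟪c - y, w - y⟫_ℝ + t ^ 2 * ‖w - y‖ ^ 2) =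
      1 / (2 * mu) * ‖y - c‖ ^ 2 - t * (mu⁻¹ * ⟪c - y, w - y⟫_ℝ)
        + t * (t * (1 / (2 * mu) * ‖w - y‖ ^ 2)) := by
      field_simp
      ring
    rw [h5] at h3
    refine nonneg_of_mul_nonneg_right (a := t) ?_ ht0
    linarith
  have hlim : Tendsto (fun t : ℝ => (ρ - r) - mu⁻¹ * ⟪c - y, w - y⟫_ℝ +
      t * (1 / (2 * mu) * ‖w - y‖ ^ 2)) (𝓝[>] 0)
      (𝓝 ((ρ - r) - mu⁻¹ * ⟪c - y, w - y⟫_ℝ + 0 * (1 / (2 * mu) * ‖w - y‖ ^ 2))) :=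
    (Continuous.tendsto (by fun_prop) 0).mono_left nhdsWithin_le_nhds
  have := ge_of_tendsto hlim (by
    filter_upwards [Ioc_mem_nhdsGT (zero_lt_one' ℝ)] with t ht using key t ht.1 ht.2)
  rw [real_inner_smul_left]
  linarith

/-- Here `m` is the minimum over the closed unit ball around `x₀`, attained by semicontinuity. A
point farther away is pulled back along its segment to the unit sphere, where the value is at least
`m`; convexity then limits the decay to a linear one. -/
lemma exists_linear_minorant [FiniteDimensional ℝ E] {f : E → EReal} (hconv : ConvexEReal f)
    (hf : ProperEReal f) (hlsc : LowerSemicontinuous f) :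
    ∃ (x₀ : E) (r m : ℝ), f x₀ = r ∧ m ≤ r ∧
      ∀ (w : E) (ρ : ℝ), f w ≤ ρ → m - ‖w - x₀‖ * (r - m) ≤ ρ := by
  obtain ⟨x₀, hx₀⟩ := hf.2
  obtain ⟨r, hr⟩ := EReal.exists_coe_eq (hf.1 x₀) hx₀
  have hmem : x₀ ∈ Metric.closedBall x₀ 1 := Metric.mem_closedBall_self zero_le_one
  obtain ⟨a, ha, hmin⟩ := LowerSemicontinuousOn.exists_isMinOn (s := Metric.closedBall x₀ 1)
    ⟨x₀, hmem⟩ (isCompact_closedBall x₀ 1) (hlsc.lowerSemicontinuousOn _)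
  have har : f a ≤ r := (hmin hmem).trans hr.le
  obtain ⟨m, hm⟩ := EReal.exists_coe_eq (hf.1 a) (ne_top_of_le_ne_top (EReal.coe_ne_top r) har)
  have hball : ∀ w ∈ Metric.closedBall x₀ 1, ∀ ρ : ℝ, f w ≤ ρ → m ≤ ρ := by
    intro w hw ρ hρ
    have := (hmin hw).trans hρ
    rwa [hm, EReal.coe_le_coe_iff] at this
  have hmr : m ≤ r := hball x₀ hmem r hr.le
  refine ⟨x₀, r, m, hr, hmr, fun w ρ hw => ?_⟩
  rcases le_total ‖w - x₀‖ 1 with hd | hd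
  · have h1 := hball w (by simpa [dist_eq_norm] using hd) ρ hw
    have : 0 ≤ ‖w - x₀‖ * (r - m) := mul_nonneg (norm_nonneg _) (sub_nonneg.2 hmr)
    linarith
  · have hd0 : 0 < ‖w - x₀‖ := one_pos.trans_le hd
    have h1 := hconv.le_of_le hr.le hw (t := ‖w - x₀‖⁻¹) (by positivity) (inv_le_one_of_one_le₀ hd)
    have h2 := hball _ (by simp [norm_smul, hd0.ne']) _ h1
    have h3 := mul_le_mul_of_nonneg_left h2 hd0.le
    have h4 : ‖w - x₀‖ * (r + ‖w - x₀‖⁻¹ * (ρ - r)) = ‖w - x₀‖ * r + (ρ - r) := by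
      field_simp
    rw [h4] at h3
    linarith

lemma exists_isMinOn_proxObjective [FiniteDimensional ℝ E] {f : E → EReal}
    (hconv : ConvexEReal f) (hf : ProperEReal f) (hlsc : LowerSemicontinuous f)
    {mu : ℝ} (hmu : 0 < mu) (c : E) :
    ∃ y, IsMinOn (proxObjective f mu c) Set.univ y := by
  obtain ⟨x₀, r, m, hr, hmr, hlow⟩ := exists_linear_minorant hconv hf hlsc
  have hg : LowerSemicontinuous (proxObjective f mu c) := by
    refine LowerSemicontinuous.add' hlsc (Continuous.lowerSemicontinuous ?_) fun x => ?_
    · exact continuous_coe_real_ereal.comp (by fun_prop)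
    · exact EReal.continuousAt_add (Or.inr (EReal.coe_ne_bot _)) (Or.inr (EReal.coe_ne_top _))
  set a := ‖x₀ - c‖ with ha
  -- With k = μ(r - m), a distance d > R satisfies d ≥ 1 and d - 2a - 2k ≥ 2k + 1, so the quadratic
  -- term outweighs the linear minorant and `x₀` does better than any point outside the ball.
  set R := 2 * a + 4 * (mu * (r - m)) + 1 with hR
  have ha0 : 0 ≤ a := norm_nonneg _
  have hk0 : 0 ≤ mu * (r - m) := mul_nonneg hmu.le (sub_nonneg.2 hmr)
  have hR0 : 0 ≤ R := by positivity
  have hmem : x₀ ∈ Metric.closedBall x₀ R := Metric.mem_closedBall_self hR0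
  obtain ⟨y, -, hmin⟩ := LowerSemicontinuousOn.exists_isMinOn (s := Metric.closedBall x₀ R)
    ⟨x₀, hmem⟩ (isCompact_closedBall x₀ R) (hg.lowerSemicontinuousOn _)
  refine ⟨y, fun w _ => ?_⟩
  by_cases hw : w ∈ Metric.closedBall x₀ R
  · exact hmin hw
  refine le_trans (b := proxObjective f mu c x₀) (hmin hmem) ?_
  by_cases hfw : f w = ⊤
  · rw [proxObjective, proxObjective, hfw, EReal.top_add_coe]
    exact le_top
  obtain ⟨ρ, hρ⟩ := EReal.exists_coe_eq (hf.1 w) hfw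
  rw [proxObjective_of_eq hr, proxObjective_of_eq hρ, EReal.coe_le_coe_iff, ← ha]
  have h1 := hlow w ρ hρ.le
  rw [Metric.mem_closedBall, dist_eq_norm, not_le] at hw
  set d := ‖w - x₀‖ with hd
  have h2 : d - a ≤ ‖w - c‖ := by
    have : w - x₀ = (w - c) - (x₀ - c) := by abel
    rw [hd, this]
    linarith [norm_sub_le (w - c) (x₀ - c)]
  have h3 : (d - a) ^ 2 ≤ ‖w - c‖ ^ 2 := pow_le_pow_left₀ (by linarith) h2 2
  have h4 : 2 * (mu * (r - m)) + 2 * (mu * (r - m)) * d + a ^ 2 ≤ (d - a) ^ 2 := by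
    have : 1 * (2 * (mu * (r - m)) + 1) ≤ d * (d - 2 * a - 2 * (mu * (r - m))) :=
      mul_le_mul (by linarith) (by linarith) (by positivity) (by linarith)
    nlinarith
  have h5 : 1 / (2 * mu) * (2 * (mu * (r - m)) + 2 * (mu * (r - m)) * d + a ^ 2) =
      (r - m) + d * (r - m) + 1 / (2 * mu) * a ^ 2 := by
    field_simp
  have h6 := mul_le_mul_of_nonneg_left (h4.trans h3) (by positivity : 0 ≤ 1 / (2 * mu))
  rw [h5] at h6
  linarith

lemma existsUnique_isMinOn_proxObjective [FiniteDimensional ℝ E] {f : E → EReal}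
    (hconv : ConvexEReal f) (hf : ProperEReal f) (hlsc : LowerSemicontinuous f)
    {mu : ℝ} (hmu : 0 < mu) (c : E) :
    ∃! y, IsMinOn (proxObjective f mu c) Set.univ y := by
  obtain ⟨y, hy⟩ := exists_isMinOn_proxObjective hconv hf hlsc hmu c
  refine ⟨y, hy, fun w hw => ?_⟩
  have h := isSubgradientAt_of_isMinOn hconv hf hmu hy
  obtain ⟨r, hr, -⟩ := id h
  obtain ⟨ρ, hρ, -⟩ := isSubgradientAt_of_isMinOn hconv hf hmu hw
  have h1 := (h.proxObjective_add_le hmu hρ).trans (hw (Set.mem_univ y))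
  rw [proxObjective_of_eq hr, ← EReal.coe_add, EReal.coe_le_coe_iff] at h1
  have h2 : 1 / (2 * mu) * ‖w - y‖ ^ 2 ≤ 0 := by linarith
  have h3 : ‖w - y‖ ^ 2 ≤ 0 := nonpos_of_mul_nonpos_right h2 (by positivity)
  simpa [sub_eq_zero] using le_antisymm h3 (sq_nonneg _)

/-- The proximal point of `f` at `c`. -/
def proxPoint (f : E → EReal) (mu : ℝ) (c : E) : E :=
  argmin (proxObjective f mu c)

lemma isSubgradientAt_proxPoint [FiniteDimensional ℝ E] {f : E → EReal}
    (hconv : ConvexEReal f) (hf : ProperEReal f) (hlsc : LowerSemicontinuous f)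
    {mu : ℝ} (hmu : 0 < mu) (c : E) :
    IsSubgradientAt f (mu⁻¹ • (c - proxPoint f mu c)) (proxPoint f mu c) :=
  isSubgradientAt_of_isMinOn hconv hf hmu
    (Classical.epsilon_spec (exists_isMinOn_proxObjective hconv hf hlsc hmu c))

lemma proxPoint_eq [FiniteDimensional ℝ E] {f : E → EReal}
    (hconv : ConvexEReal f) (hf : ProperEReal f) (hlsc : LowerSemicontinuous f)
    {mu : ℝ} (hmu : 0 < mu) {c y : E} (h : IsSubgradientAt f (mu⁻¹ • (c - y)) y) :
    proxPoint f mu c = y :=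
  (existsUnique_isMinOn_proxObjective hconv hf hlsc hmu c).unique
    (Classical.epsilon_spec (exists_isMinOn_proxObjective hconv hf hlsc hmu c))
    (h.isMinOn_proxObjective hf.1 hmu)

/-- Firm nonexpansiveness of the proximal map, which is monotonicity of the subgradients multiplied
by `mu`. -/
lemma inner_proxPoint_sub_nonneg [FiniteDimensional ℝ E] {f : E → EReal}
    (hconv : ConvexEReal f) (hf : ProperEReal f) (hlsc : LowerSemicontinuous f)
    {mu : ℝ} (hmu : 0 < mu) (c c' : E) :
    0 ≤ ⟪(c - c') - (proxPoint f mu c - proxPoint f mu c'),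
      proxPoint f mu c - proxPoint f mu c'⟫_ℝ := by
  have h := (isSubgradientAt_proxPoint hconv hf hlsc hmu c).inner_sub_nonneg
    (isSubgradientAt_proxPoint hconv hf hlsc hmu c')
  rw [← smul_sub, real_inner_smul_left] at h
  have h1 := nonneg_of_mul_nonneg_right h (inv_pos.2 hmu)
  rwa [sub_sub_sub_comm] at h1

lemma continuous_proxPoint [FiniteDimensional ℝ E] {f : E → EReal}
    (hconv : ConvexEReal f) (hf : ProperEReal f) (hlsc : LowerSemicontinuous f)
    {mu : ℝ} (hmu : 0 < mu) : Continuous (proxPoint f mu) := by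
  refine (LipschitzWith.of_dist_le_mul (K := 1) fun c c' => ?_).continuous
  have h := inner_proxPoint_sub_nonneg hconv hf hlsc hmu c c'
  rw [inner_sub_left, real_inner_self_eq_norm_sq] at h
  have h1 := real_inner_le_norm (c - c') (proxPoint f mu c - proxPoint f mu c')
  rw [dist_eq_norm, dist_eq_norm, NNReal.coe_one, one_mul]
  by_contra! h2
  have h3 : 0 < ‖proxPoint f mu c - proxPoint f mu c'‖ := (norm_nonneg _).trans_lt h2
  nlinarith

end Subgradient

/-! ### Almost sure convergence along a randomized iteration -/

section RandomIteration

variable {X ι : Type*} {Ω : Type*} {mΩ : MeasurableSpace Ω} {g : X → ι → X} {x : ℕ → Ω → X}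
  {draw : ℕ → Ω → ι} {x₀ : X}

/-- Finitely many draws reach finitely many points. Hence any real function of an iterate is
bounded, and integrability needs no regularity of that function. -/
lemma finite_range_of_recursion [Finite ι] (h0 : ∀ ω, x 0 ω = x₀)
    (hstep : ∀ k ω, x (k + 1) ω = g (x k ω) (draw k ω)) (k : ℕ) : (Set.range (x k)).Finite := by
  induction k with
  | zero => exact (Set.finite_singleton x₀).subset (by rintro _ ⟨ω, rfl⟩; exact h0 ω)
  | succ k ih =>
    refine (ih.image2 g (Set.finite_univ (α := ι))).subset ?_
    rintro _ ⟨ω, rfl⟩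
    exact ⟨x k ω, ⟨ω, rfl⟩, draw k ω, trivial, (hstep k ω).symm⟩

lemma exists_bound_of_recursion [Finite ι] (h0 : ∀ ω, x 0 ω = x₀)
    (hstep : ∀ k ω, x (k + 1) ω = g (x k ω) (draw k ω)) (k : ℕ) (V : X → ℝ) :
    ∃ C, ∀ ω, ‖V (x k ω)‖ ≤ C := by
  obtain ⟨C, hC⟩ := ((finite_range_of_recursion h0 hstep k).image (fun y => ‖V y‖)).bddAbove
  exact ⟨C, fun ω => hC ⟨x k ω, ⟨ω, rfl⟩, rfl⟩⟩

variable [MeasurableSpace ι]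

/-- The filtration of the draws made strictly before each time. -/
def drawFiltration (draw : ℕ → Ω → ι) (hmeas : ∀ k, Measurable (draw k)) : Filtration ℕ mΩ where
  seq k := ⨆ j ∈ Set.Iio k, MeasurableSpace.comap (draw j) inferInstance
  mono' _ _ h := biSup_mono fun _ hj => lt_of_lt_of_le hj h
  le' _ := iSup₂_le fun j _ => (hmeas j).comap_le

lemma indep_drawFiltration {draw : ℕ → Ω → ι} (hmeas : ∀ k, Measurable (draw k))
    {Pr : Measure Ω} (hindep : iIndepFun draw Pr) (k : ℕ) :
    Indep (MeasurableSpace.comap (draw k) inferInstance) (drawFiltration draw hmeas k) Pr := by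
  have h := indep_iSup_of_disjoint (fun j => (hmeas j).comap_le) hindep
    (S := {k}) (T := Set.Iio k) (by simp)
  simpa [drawFiltration] using h

lemma measurable_draw_succ {draw : ℕ → Ω → ι} (hmeas : ∀ k, Measurable (draw k)) (k : ℕ) :
    Measurable[drawFiltration draw hmeas (k + 1)] (draw k) := by
  refine Measurable.mono (comap_measurable (draw k)) ?_ le_rfl
  exact le_biSup (fun j => MeasurableSpace.comap (draw j) inferInstance)
    (Set.mem_Iio.2 (Nat.lt_succ_self k))

variable [Fintype ι] [MeasurableSingletonClass ι]

/-- Splitting by the value of the last draw reduces to the previous iterate. `A` is arbitrary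
because `X` carries no σ-algebra. -/
lemma measurableSet_of_recursion (hmeas : ∀ k, Measurable (draw k)) (h0 : ∀ ω, x 0 ω = x₀)
    (hstep : ∀ k ω, x (k + 1) ω = g (x k ω) (draw k ω)) (k : ℕ) (A : Set X) :
    MeasurableSet[drawFiltration draw hmeas k] (x k ⁻¹' A) := by
  induction k generalizing A with
  | zero =>
    have : x 0 = fun _ => x₀ := funext h0
    rw [this]
    exact @MeasurableSet.const _ (drawFiltration draw hmeas 0) (x₀ ∈ A)
  | succ k ih =>
    have : x (k + 1) ⁻¹' A = ⋃ s, (draw k ⁻¹' {s}) ∩ (x k ⁻¹' {y | g y s ∈ A}) := by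
      ext ω
      simp [hstep]
    rw [this]
    refine @MeasurableSet.iUnion _ _ (drawFiltration draw hmeas (k + 1)) _ _ fun s => ?_
    refine @MeasurableSet.inter _ (drawFiltration draw hmeas (k + 1)) _ _ ?_ ?_
    · exact measurable_draw_succ hmeas k (measurableSet_singleton s)
    · exact (drawFiltration draw hmeas).mono (Nat.le_succ k) _ (ih _)

lemma stronglyMeasurable_of_recursion (hmeas : ∀ k, Measurable (draw k)) (h0 : ∀ ω, x 0 ω = x₀)
    (hstep : ∀ k ω, x (k + 1) ω = g (x k ω) (draw k ω)) (k : ℕ) (V : X → ℝ) :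
    StronglyMeasurable[drawFiltration draw hmeas k] (fun ω => V (x k ω)) := by
  have h : Measurable[drawFiltration draw hmeas k] (fun ω => V (x k ω)) :=
    fun A _ => measurableSet_of_recursion hmeas h0 hstep k (V ⁻¹' A)
  exact h.stronglyMeasurable

variable {Pr : Measure Ω} [IsProbabilityMeasure Pr]

lemma integrable_of_recursion (hmeas : ∀ k, Measurable (draw k)) (h0 : ∀ ω, x 0 ω = x₀)
    (hstep : ∀ k ω, x (k + 1) ω = g (x k ω) (draw k ω)) (k : ℕ) (V : X → ℝ) :
    Integrable (fun ω => V (x k ω)) Pr := by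
  obtain ⟨C, hC⟩ := exists_bound_of_recursion h0 hstep k V
  exact Integrable.of_bound ((stronglyMeasurable_of_recursion hmeas h0 hstep k V).mono
    ((drawFiltration draw hmeas).le k)).aestronglyMeasurable C (ae_of_all _ hC)

/-- Split over the value `s` of the current draw: `V (g (x k ω) s)` is known at time `k` and factors
out, while the indicator of the draw is independent of the past and averages to `q s`. -/
lemma condExp_recursion (hmeas : ∀ k, Measurable (draw k)) (hindep : iIndepFun draw Pr)
    {q : ι → ℝ} (hlaw : ∀ k s, Pr.real {ω | draw k ω = s} = q s) (h0 : ∀ ω, x 0 ω = x₀)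
    (hstep : ∀ k ω, x (k + 1) ω = g (x k ω) (draw k ω)) (k : ℕ) (V : X → ℝ) :
    Pr[fun ω => V (x (k + 1) ω) | drawFiltration draw hmeas k] =ᵐ[Pr]
      fun ω => ∑ s, q s * V (g (x k ω) s) := by
  have hle : (drawFiltration draw hmeas k : MeasurableSpace Ω) ≤ mΩ := (drawFiltration draw hmeas).le k
  let ind : ι → Ω → ℝ := fun s => (draw k ⁻¹' {s}).indicator 1
  have hset : ∀ s, MeasurableSet (draw k ⁻¹' {s}) := fun s =>
    hmeas k (measurableSet_singleton s)
  have hind : ∀ s, Integrable (ind s) Pr := fun s =>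
    (integrable_const (1 : ℝ)).indicator (hset s)
  have hdecomp : (fun ω => V (x (k + 1) ω)) =
      ∑ s, (fun ω => V (g (x k ω) s)) * ind s := by
    classical
    ext ω
    simp [ind, hstep, Set.indicator_apply, Finset.sum_apply, eq_comm]
  have hprod : ∀ s, Integrable ((fun ω => V (g (x k ω) s)) * ind s) Pr := fun s => by
    obtain ⟨C, hC⟩ := exists_bound_of_recursion h0 hstep k (fun y => V (g y s))
    exact (hind s).bdd_mul ((stronglyMeasurable_of_recursion hmeas h0 hstep k
      (fun y => V (g y s))).mono hle).aestronglyMeasurable (ae_of_all _ hC)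
  have hpull : ∀ s, Pr[(fun ω => V (g (x k ω) s)) * ind s | drawFiltration draw hmeas k] =ᵐ[Pr]
      fun ω => q s * V (g (x k ω) s) := fun s => by
    have h1 := condExp_mul_of_stronglyMeasurable_left
      (stronglyMeasurable_of_recursion hmeas h0 hstep k (fun y => V (g y s))) (hprod s) (hind s)
    have h2 : Pr[ind s | drawFiltration draw hmeas k] =ᵐ[Pr] fun _ => q s := by
      have h3 := condExp_indep_eq (f := ind s) (hmeas k).comap_le hle (μ := Pr)
        (StronglyMeasurable.indicator stronglyMeasurable_one
          ⟨{s}, measurableSet_singleton s, rfl⟩) (indep_drawFiltration hmeas hindep k)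
      have h4 : Pr[ind s] = q s := by
        exact (integral_indicator_one (hset s)).trans (hlaw k s)
      rwa [h4] at h3
    filter_upwards [h1, h2] with ω hω1 hω2
    rw [hω1, Pi.mul_apply, hω2, mul_comm]
  rw [hdecomp]
  refine (condExp_finsetSum (fun s _ => hprod s) _).trans ?_
  have hall : ∀ᵐ ω ∂Pr, ∀ s, (Pr[(fun ω => V (g (x k ω) s)) * ind s | drawFiltration draw hmeas k]) ω =
      q s * V (g (x k ω) s) := ae_all_iff.2 hpull
  filter_upwards [hall] with ω hω
  simp [Finset.sum_apply, hω]

/-- Almost sure convergence of a Lyapunov function along a randomized iteration. -/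
theorem ae_tendsto_of_recursion (hmeas : ∀ k, Measurable (draw k)) (hindep : iIndepFun draw Pr)
    {q : ι → ℝ} (hlaw : ∀ k s, Pr.real {ω | draw k ω = s} = q s) (h0 : ∀ ω, x 0 ω = x₀)
    (hstep : ∀ k ω, x (k + 1) ω = g (x k ω) (draw k ω))
    {V D : X → ℝ} (hV : ∀ y, 0 ≤ V y) (hD : ∀ y, 0 ≤ D y)
    (hdesc : ∀ y, ∑ s, q s * V (g y s) ≤ V y - D y) :
    ∀ᵐ ω ∂Pr, (∃ c, Tendsto (fun k => V (x k ω)) atTop (𝓝 c)) ∧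
      Tendsto (fun k => D (x k ω)) atTop (𝓝 0) := by
  let ℱ := drawFiltration draw hmeas
  -- Adding back the accumulated decreases keeps the process a nonnegative supermartingale; its
  -- convergence controls `V` and the series of `D` together.
  let U : ℕ → Ω → ℝ := fun k ω => V (x k ω) + ∑ j ∈ Finset.range k, D (x j ω)
  have hU0 : ∀ k ω, 0 ≤ U k ω := fun k ω =>
    add_nonneg (hV _) (Finset.sum_nonneg fun j _ => hD _)
  have hSmeas : ∀ k i, i ≤ k + 1 →
      StronglyMeasurable[ℱ k] (fun ω => ∑ j ∈ Finset.range i, D (x j ω)) := fun k i hi =>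
    Finset.stronglyMeasurable_fun_sum _ fun j hj =>
      (stronglyMeasurable_of_recursion hmeas h0 hstep j D).mono
        (ℱ.mono (Nat.lt_succ_iff.1 ((Finset.mem_range.1 hj).trans_le hi)))
  have hSint : ∀ i, Integrable (fun ω => ∑ j ∈ Finset.range i, D (x j ω)) Pr := fun i =>
    integrable_finsetSum _ fun j _ => integrable_of_recursion hmeas h0 hstep j D
  have hUint : ∀ k, Integrable (U k) Pr := fun k =>
    (integrable_of_recursion hmeas h0 hstep k V).add (hSint k)
  have hsuper : Supermartingale U ℱ Pr := by
    refine supermartingale_nat (fun k => ?_) hUint fun k => ?_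
    · exact (stronglyMeasurable_of_recursion hmeas h0 hstep k V).add (hSmeas k k k.le_succ)
    · have h1 := condExp_add (integrable_of_recursion (Pr := Pr) hmeas h0 hstep (k + 1) V)
        (hSint (k + 1)) (ℱ k)
      have h2 := condExp_recursion hmeas hindep hlaw h0 hstep k V
      have h3 := condExp_of_stronglyMeasurable (ℱ.le k) (hSmeas k _ le_rfl) (hSint (k + 1))
      filter_upwards [h1, h2] with ω hω1 hω2
      refine hω1.le.trans ?_
      rw [Pi.add_apply, h3, hω2]
      have := hdesc (x k ω)
      simp only [U, Finset.sum_range_succ]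
      linarith
  have hint : ∀ k, ∫ ω, U k ω ∂Pr ≤ V x₀ := fun k => by
    have := hsuper.setIntegral_le k.zero_le (@MeasurableSet.univ _ (ℱ 0))
    simpa [U, h0] using this
  -- The convergence theorem is for submartingales, hence the negation. Since `U` is nonnegative,
  -- its L¹ norm is its expectation, at most `V x₀`.
  have hconv := hsuper.neg.exists_ae_tendsto_of_bdd (R := (V x₀).toNNReal) fun k => by
    rw [Pi.neg_apply, eLpNorm_neg, eLpNorm_one_eq_lintegral_enorm,
      ← ofReal_integral_norm_eq_lintegral_enorm (hUint k), ENNReal.ofReal]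
    refine ENNReal.coe_le_coe.2 (Real.toNNReal_mono ?_)
    simpa only [Real.norm_of_nonneg (hU0 k _)] using hint k
  filter_upwards [hconv] with ω hω
  obtain ⟨c, hc⟩ := hω
  have hUc : Tendsto (fun k => U k ω) atTop (𝓝 (-c)) := by
    simpa using hc.neg
  obtain ⟨B, hB⟩ := hUc.bddAbove_range
  have hsum : Summable fun j => D (x j ω) := by
    refine summable_of_sum_range_le (c := B) (fun j => hD _) fun k => ?_
    have h1 : U k ω ≤ B := hB ⟨k, rfl⟩
    have h2 := hV (x k ω)
    simp only [U] at h1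
    linarith
  refine ⟨⟨-c - ∑' j, D (x j ω), ?_⟩, hsum.tendsto_atTop_zero⟩
  refine (hUc.sub hsum.hasSum.tendsto_sum_nat).congr fun k => ?_
  simp [U]

end RandomIteration

/-- Opial's argument in a proper metric space. -/
theorem exists_tendsto_of_dist_tendsto {X : Type*} [MetricSpace X] [ProperSpace X] {F D : Set X}
    (hD : D.Nonempty) (hFD : F ⊆ closure D) {x : ℕ → X}
    (hdist : ∀ y ∈ D, ∃ c, Tendsto (fun k => dist (x k) y) atTop (𝓝 c))
    (hcluster : ∀ (a : X) (φ : ℕ → ℕ), StrictMono φ → Tendsto (x ∘ φ) atTop (𝓝 a) → a ∈ F) :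
    ∃ a ∈ F, Tendsto x atTop (𝓝 a) := by
  obtain ⟨y, hy⟩ := hD
  obtain ⟨c, hc⟩ := hdist y hy
  obtain ⟨B, hB⟩ := hc.bddAbove_range
  obtain ⟨a, -, φ, hφ, ha⟩ := (isCompact_closedBall y B).tendsto_subseq (x := x)
    fun k => hB ⟨k, rfl⟩
  have haF := hcluster a φ hφ ha
  refine ⟨a, haF, Metric.tendsto_atTop.2 fun ε hε => ?_⟩
  -- Distances to `a` itself are not known to converge, so a nearby `b` in `D` replaces it: the
  -- limit of `dist (x k) b` equals `dist a b` along the subsequence, hence along the whole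
  -- sequence.
  obtain ⟨b, hb, hab⟩ := Metric.mem_closure_iff.1 (hFD haF) (ε / 2) (half_pos hε)
  obtain ⟨l, hl⟩ := hdist b hb
  have hl' : l = dist a b :=
    tendsto_nhds_unique (hl.comp hφ.tendsto_atTop) (ha.dist tendsto_const_nhds)
  obtain ⟨N, hN⟩ := eventually_atTop.1 (hl.eventually_lt_const (hl' ▸ hab))
  refine ⟨N, fun k hk => ?_⟩
  have h1 := dist_triangle_right (x k) a b
  linarith [hN k hk]

/-! ### Fenchel duality by extension of a positive functional -/

section Duality

variable {V : Type*} [AddCommGroup V] [Module ℝ V]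

lemma exists_add_smul_mem_of_mem_intrinsicInterior [TopologicalSpace V] [ContinuousAdd V]
    [ContinuousSMul ℝ V] {s : Set V} {a l : V} (ha : a ∈ intrinsicInterior ℝ s)
    (hl : l ∈ (affineSpan ℝ s).direction) : ∃ ε : ℝ, 0 < ε ∧ a + ε • l ∈ s := by
  obtain ⟨a', ha', rfl⟩ := ha
  have hmem : ∀ t : ℝ, (a' : V) + t • l ∈ affineSpan ℝ s := fun t => by
    rw [add_comm]
    exact AffineSubspace.vadd_mem_of_mem_direction (Submodule.smul_mem _ t hl) a'.2
  let γ : ℝ → affineSpan ℝ s := fun t => ⟨(a' : V) + t • l, hmem t⟩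
  have hγ : Continuous γ := Continuous.subtype_mk (by fun_prop) _
  have hγ0 : γ 0 = a' := Subtype.ext (by simp [γ])
  have hnhds : ∀ᶠ t in 𝓝 (0 : ℝ), γ t ∈ ((↑) ⁻¹' s : Set (affineSpan ℝ s)) :=
    hγ.continuousAt.eventually_mem (by rw [hγ0]; exact mem_interior_iff_mem_nhds.1 ha')
  obtain ⟨ε, hε, hε0⟩ := ((hnhds.filter_mono nhdsWithin_le_nhds).and
    (self_mem_nhdsWithin (s := Set.Ioi (0 : ℝ)))).exists
  exact ⟨ε, hε0, hε⟩

/-- The cone generated by an epigraph, translated down by `c`, and a subspace. -/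
def epigraphCone {epi : Set (V × ℝ)} (hconv : Convex ℝ epi) (hne : epi.Nonempty)
    (W : Submodule ℝ V) (c : ℝ) : PointedCone ℝ (V × ℝ) where
  carrier := {p | ∃ t : ℝ, 0 ≤ t ∧ ∃ x r, (x, r) ∈ epi ∧ ∃ w ∈ W, p = (t • x + w, t * (r - c))}
  zero_mem' := by
    obtain ⟨⟨x, r⟩, h⟩ := hne
    exact ⟨0, le_rfl, x, r, h, 0, W.zero_mem, by ext <;> simp⟩
  add_mem' := by
    rintro _ _ ⟨t, ht, x, r, h, w, hw, rfl⟩ ⟨t', ht', x', r', h', w', hw', rfl⟩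
    rcases (add_nonneg ht ht').eq_or_lt with h0 | h0
    · have h1 : t = 0 := by linarith
      have h2 : t' = 0 := by linarith
      subst h1 h2
      exact ⟨0, le_rfl, x, r, h, w + w', W.add_mem hw hw', by simp⟩
    · have hmem := hconv h h' (a := t / (t + t')) (b := t' / (t + t')) (by positivity)
        (by positivity) (by field_simp)
      simp only [Prod.smul_mk, Prod.mk_add_mk, smul_eq_mul] at hmem
      refine ⟨t + t', h0.le, _, _, hmem, w + w', W.add_mem hw hw', ?_⟩
      ext
      · simp only [Prod.mk_add_mk, smul_add, smul_smul, mul_div_cancel₀ _ h0.ne']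
        abel
      · simp only [Prod.mk_add_mk]
        field_simp
        ring
  smul_mem' := by
    rintro ⟨a, ha⟩ _ ⟨t, ht, x, r, h, w, hw, rfl⟩
    refine ⟨a * t, mul_nonneg ha ht, x, r, h, a • w, W.smul_mem a hw, ?_⟩
    ext
    · simp [Nonneg.mk_smul, smul_smul]
    · simp [Nonneg.mk_smul, mul_assoc]

/-- Riesz extension of the height functional on `{0} × ℝ` to one nonnegative on `epigraphCone`.
Minimality of `c` gives positivity on the initial line, and `hreach` the domination that the
extension requires. The multiplier is minus the restriction of the extension to `V`. -/
lemma exists_linearMap_of_forall_le_of_codisjoint {epi : Set (V × ℝ)} (hconv : Convex ℝ epi)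
    {W : Submodule ℝ V} {c : ℝ} (hmin : ∀ w ∈ W, ∀ r, (w, r) ∈ epi → c ≤ r)
    (hreach : ∀ h : V, ∃ t : ℝ, 0 ≤ t ∧ ∃ x r, (x, r) ∈ epi ∧ ∃ w ∈ W, h = t • x + w) :
    ∃ ℓ : V →ₗ[ℝ] ℝ, (∀ w ∈ W, ℓ w = 0) ∧ ∀ x r, (x, r) ∈ epi → c + ℓ x ≤ r := by
  have hne : epi.Nonempty := by
    obtain ⟨-, -, x, r, h, -⟩ := hreach 0
    exact ⟨_, h⟩
  let f : V × ℝ →ₗ.[ℝ] ℝ :=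
    { domain := Submodule.prod ⊥ ⊤
      toFun := (LinearMap.snd ℝ V ℝ).comp (Submodule.subtype _) }
  obtain ⟨g, hgf, hg⟩ := riesz_extension (epigraphCone hconv hne W c) f (by
      rintro ⟨⟨h, ρ⟩, hdom⟩ ⟨t, ht, x, r, hx, w, hw, heq⟩
      obtain rfl : h = 0 := hdom.1
      obtain ⟨h1, rfl⟩ := Prod.mk.inj heq
      change 0 ≤ t * (r - c)
      rcases ht.eq_or_lt with rfl | ht
      · simp
      · refine mul_nonneg ht.le (sub_nonneg.2 (hmin x ?_ r hx))
        have h2 : t • x = -w := by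
          rw [eq_neg_iff_add_eq_zero]
          exact h1.symm
        have h3 : x = t⁻¹ • (-w) := by rw [← h2, inv_smul_smul₀ ht.ne']
        rw [h3]
        exact W.smul_mem _ (W.neg_mem hw)) (by
      rintro ⟨h, ρ⟩
      obtain ⟨t, ht, x, r, hx, w, hw, rfl⟩ := hreach h
      refine ⟨⟨(0, t * (r - c) - ρ), by simp [f]⟩, t, ht, x, r, hx, w, hw, ?_⟩
      simp)
  have hsnd : ∀ r : ℝ, g (0, r) = r := fun r => hgf ⟨(0, r), by simp [f]⟩
  have hsplit : ∀ (h : V) (r : ℝ), g (h, r) = g (h, 0) + r := fun h r => by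
    conv_rhs => rw [← hsnd r, ← map_add]
    simp
  -- Both `w` and `-w` lie in the cone at height 0, which forces the functional to vanish on `W`.
  have hnonneg : ∀ w ∈ W, 0 ≤ g (w, 0) := fun w hw => by
    obtain ⟨⟨x, r⟩, hx⟩ := hne
    exact hg _ ⟨0, le_rfl, x, r, hx, w, hw, by simp⟩
  refine ⟨-(g.comp (LinearMap.inl ℝ V ℝ)), fun w hw => ?_, fun x r hx => ?_⟩
  · have h1 := hnonneg w hw
    have h2 := hnonneg (-w) (W.neg_mem hw)
    have h3 : g (-w, 0) = -g (w, 0) := by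
      rw [← map_neg, Prod.neg_mk, neg_zero]
    simp only [LinearMap.neg_apply, LinearMap.comp_apply, LinearMap.inl_apply]
    linarith
  · have h1 := hg (x, r - c) ⟨1, zero_le_one, x, r, hx, 0, W.zero_mem, by simp⟩
    rw [hsplit] at h1
    simp only [LinearMap.neg_apply, LinearMap.comp_apply, LinearMap.inl_apply]
    linarith

/-- Fenchel duality: existence of a multiplier for the minimization of a convex function, given by
its epigraph, over a subspace that meets the relative interior of its domain. -/
theorem exists_linearMap_of_forall_le [TopologicalSpace V] [ContinuousAdd V]
    [ContinuousSMul ℝ V] {epi : Set (V × ℝ)} (hconv : Convex ℝ epi)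
    {W : Submodule ℝ V} {c : ℝ} (hmin : ∀ w ∈ W, ∀ r, (w, r) ∈ epi → c ≤ r)
    (hri : ((W : Set V) ∩ intrinsicInterior ℝ (Prod.fst '' epi)).Nonempty) :
    ∃ ℓ : V →ₗ[ℝ] ℝ, (∀ w ∈ W, ℓ w = 0) ∧ ∀ x r, (x, r) ∈ epi → c + ℓ x ≤ r := by
  obtain ⟨a, haW, ha⟩ := hri
  set L := (affineSpan ℝ (Prod.fst '' epi)).direction with hL
  -- Enlarging `W` by a complement `N` makes every vector reachable. It costs nothing: a domain
  -- point of `W ⊔ N` has its `N`-component in `W ⊔ L`, so that component is 0.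
  obtain ⟨N, hN⟩ := Submodule.exists_isCompl (W ⊔ L)
  have hadom : a ∈ Prod.fst '' epi := intrinsicInterior_subset ha
  obtain ⟨ℓ, hℓ, hle⟩ := exists_linearMap_of_forall_le_of_codisjoint hconv (W := W ⊔ N) (c := c)
    (by
      intro w hw r hr
      obtain ⟨w₀, hw₀, n, hn, rfl⟩ := Submodule.mem_sup.1 hw
      have h1 : (w₀ + n) - a ∈ L := AffineSubspace.vsub_mem_direction
        (subset_affineSpan ℝ _ ⟨_, hr, rfl⟩) (subset_affineSpan ℝ _ hadom)
      have h2 : n ∈ W ⊔ L := by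
        have : n = (a - w₀) + ((w₀ + n) - a) := by abel
        rw [this]
        exact Submodule.add_mem_sup (W.sub_mem haW hw₀) h1
      have h3 : n = 0 := Submodule.disjoint_def.1 hN.disjoint n h2 hn
      subst h3
      exact hmin _ (by simpa using hw₀) r hr)
    (by
      intro h
      have hh : h ∈ (W ⊔ L) ⊔ N := by
        rw [hN.sup_eq_top]
        trivial
      obtain ⟨wl, hwl, n, hn, rfl⟩ := Submodule.mem_sup.1 hh
      obtain ⟨w, hw, l, hl, rfl⟩ := Submodule.mem_sup.1 hwl
      -- A small move from `a` along `l` stays in the domain, so `l` is a positive multiple of a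
      -- domain point minus a multiple of `a`, which lies in `W`.
      obtain ⟨ε, hε, ⟨x, r⟩, hx, hxeq⟩ := exists_add_smul_mem_of_mem_intrinsicInterior ha hl
      refine ⟨ε⁻¹, by positivity, x, r, hx, (w - ε⁻¹ • a) + n,
        Submodule.add_mem_sup (W.sub_mem hw (W.smul_mem _ haW)) hn, ?_⟩
      have hx' : x = a + ε • l := hxeq
      rw [hx', smul_add, inv_smul_smul₀ hε.ne']
      abel)
  exact ⟨ℓ, fun w hw => hℓ w (Submodule.mem_sup_left hw), hle⟩

end Duality

/-! ### Multipliers and optimality for the multistage problem -/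

lemma EReal.coe_finsetSum {ι : Type*} (s : Finset ι) (f : ι → ℝ) :
    ((∑ i ∈ s, f i : ℝ) : EReal) = ∑ i ∈ s, (f i : EReal) := by
  classical
  induction s using Finset.induction_on with
  | empty => simp
  | insert a s ha ih => rw [Finset.sum_insert ha, Finset.sum_insert ha, EReal.coe_add, ih]

lemma EReal.finsetSum_ne_bot {ι : Type*} {s : Finset ι} {f : ι → EReal}
    (h : ∀ i ∈ s, f i ≠ ⊥) : ∑ i ∈ s, f i ≠ ⊥ := by
  classical
  induction s using Finset.induction_on with
  | empty => simp
  | insert a s ha ih =>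
    rw [Finset.sum_insert ha, Ne, EReal.add_eq_bot_iff, not_or]
    exact ⟨h a (Finset.mem_insert_self a s),
      ih fun i hi => h i (Finset.mem_insert_of_mem hi)⟩

namespace MultistageProblem

variable {S T : ℕ} {n : Fin T → ℕ} {Ξ : Fin (T - 1) → Type*} {M : MultistageProblem S T n Ξ}

lemma objective_eq_coe {x : FullVar S n} {ρ : Fin S → ℝ} (h : ∀ s, M.cost s (x s) = ρ s) :
    M.objective x = ((∑ s, M.prob s * ρ s : ℝ) : EReal) := by
  simp [objective, h, EReal.coe_finsetSum, EReal.coe_mul]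

/-- One infinite cost makes the objective infinite: its weight is positive, and no other term is `⊥`
to cancel it. -/
lemma exists_cost_eq_coe (hprob : ∀ s, 0 < M.prob s) (hbot : ∀ s x, M.cost s x ≠ ⊥)
    {x : FullVar S n} (hx : M.objective x < ⊤) : ∃ ρ : Fin S → ℝ, ∀ s, M.cost s (x s) = ρ s := by
  suffices h : ∀ s, M.cost s (x s) ≠ ⊤ by
    exact ⟨fun s => (M.cost s (x s)).toReal, fun s => (EReal.coe_toReal (h s) (hbot s _)).symm⟩
  intro s hs
  refine hx.ne ?_
  rw [objective, ← Finset.add_sum_erase _ _ (Finset.mem_univ s), hs,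
    EReal.coe_mul_top_of_pos (hprob s), EReal.top_add_of_ne_bot]
  refine EReal.finsetSum_ne_bot fun i _ => ?_
  rw [Ne, EReal.mul_eq_bot]
  simp [hbot, not_lt.2 (hprob i).le]

/-- The epigraph of the objective, in terms of real bounds on the costs of the scenarios. -/
def epigraph (M : MultistageProblem S T n Ξ) : Set (FullVar S n × ℝ) :=
  {p | ∃ ρ : Fin S → ℝ, (∀ s, M.cost s (p.1 s) ≤ ρ s) ∧ ∑ s, M.prob s * ρ s ≤ p.2}

lemma convex_epigraph (hconvex : ∀ s, ConvexEReal (M.cost s)) :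
    Convex ℝ M.epigraph := by
  rintro ⟨x, r⟩ ⟨ρ, hρ, hr⟩ ⟨y, r'⟩ ⟨ρ', hρ', hr'⟩ a b ha hb hab
  refine ⟨fun s => a * ρ s + b * ρ' s, fun s => ?_, ?_⟩
  · exact hconvex s (x := (x s, ρ s)) (hρ s) (y := (y s, ρ' s)) (hρ' s) ha hb hab
  · have h1 : ∑ s, M.prob s * (a * ρ s + b * ρ' s) =
        a * ∑ s, M.prob s * ρ s + b * ∑ s, M.prob s * ρ' s := by
      rw [Finset.mul_sum, Finset.mul_sum, ← Finset.sum_add_distrib]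
      exact Finset.sum_congr rfl fun s _ => by ring
    rw [h1]
    exact add_le_add (mul_le_mul_of_nonneg_left hr ha) (mul_le_mul_of_nonneg_left hr' hb)

lemma fst_image_epigraph (hprob : ∀ s, 0 < M.prob s) (hbot : ∀ s x, M.cost s x ≠ ⊥) :
    Prod.fst '' M.epigraph = M.domain := by
  ext x
  constructor
  · rintro ⟨⟨x, r⟩, ⟨ρ, hρ, -⟩, rfl⟩
    have h : ∀ s, M.cost s (x s) = ((M.cost s (x s)).toReal : EReal) := fun s =>
      (EReal.coe_toReal (ne_top_of_le_ne_top (EReal.coe_ne_top _) (hρ s)) (hbot s _)).symm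
    change M.objective x < ⊤
    rw [objective_eq_coe h]
    exact EReal.coe_lt_top _
  · intro hx
    obtain ⟨ρ, hρ⟩ := exists_cost_eq_coe hprob hbot hx
    exact ⟨(x, _), ⟨ρ, fun s => (hρ s).le, le_rfl⟩, rfl⟩

/-- Existence of multipliers for the nonanticipativity constraint at a solution. -/
theorem exists_multiplier (hprob : ∀ s, 0 < M.prob s) (hconvex : ∀ s, ConvexEReal (M.cost s))
    (hbot : ∀ s x, M.cost s x ≠ ⊥)
    (hri : ((M.nonanticipative : Set (FullVar S n)) ∩ intrinsicInterior ℝ M.domain).Nonempty)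
    {x : FullVar S n} (hx : M.IsSolution x) :
    ∃ u : FullVar S n, (∀ w ∈ M.nonanticipative, ∑ s, M.prob s * ⟪u s, w s⟫_ℝ = 0) ∧
      ∀ s, IsSubgradientAt (M.cost s) (u s) (x s) := by
  have hxdom : M.objective x < ⊤ := by
    obtain ⟨a, haW, ha⟩ := hri
    have hadom : a ∈ M.domain := intrinsicInterior_subset ha
    exact lt_of_le_of_lt (b := M.objective a) (hx.2 haW) hadom
  obtain ⟨r, hr⟩ := exists_cost_eq_coe hprob hbot hxdom
  obtain ⟨ℓ, hℓ, hle⟩ := exists_linearMap_of_forall_le (convex_epigraph hconvex)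
    (W := M.nonanticipative) (c := ∑ s, M.prob s * r s) (by
      rintro w hw a ⟨ρ, hρ, ha⟩
      have h : ∀ s, M.cost s (w s) = ((M.cost s (w s)).toReal : EReal) := fun s =>
        (EReal.coe_toReal (ne_top_of_le_ne_top (EReal.coe_ne_top _) (hρ s)) (hbot s _)).symm
      have h1 : M.objective x ≤ M.objective w := hx.2 hw
      rw [objective_eq_coe hr, objective_eq_coe h, EReal.coe_le_coe_iff] at h1
      refine h1.trans (le_trans (Finset.sum_le_sum fun s _ => ?_) ha)
      refine mul_le_mul_of_nonneg_left ?_ (hprob s).le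
      have := hρ s
      rwa [h s, EReal.coe_le_coe_iff] at this)
    (by rwa [fst_image_epigraph hprob hbot])
  -- Riesz representation of `ℓ` row by row; dividing by `prob s` makes it the pairing with `u` in
  -- the weighted inner product.
  let u : FullVar S n := fun s => (M.prob s)⁻¹ • (InnerProductSpace.toDual ℝ (Decision n)).symm
    (LinearMap.toContinuousLinearMap (ℓ.comp (LinearMap.single ℝ (fun _ => Decision n) s)))
  have hu : ∀ s v, M.prob s * ⟪u s, v⟫_ℝ = ℓ (Pi.single s v) := fun s v => by
    simp only [u]
    rw [real_inner_smul_left, mul_inv_cancel_left₀ (hprob s).ne',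
      InnerProductSpace.toDual_symm_apply]
    rfl
  refine ⟨u, fun w hw => ?_, fun s => ⟨r s, hr s, fun v ρ hv => ?_⟩⟩
  · simp only [hu]
    rw [← map_sum, Finset.univ_sum_single, hℓ w hw]
  -- Only row `s` is perturbed, so the other rows cancel and the joint inequality reduces to the one
  -- for `cost s`.
  · have h1 := hle (x + Pi.single s (v - x s)) (∑ σ, M.prob σ * Function.update r s ρ σ)
      ⟨Function.update r s ρ, fun σ => ?_, le_rfl⟩
    · rw [map_add, hℓ x hx.1, zero_add, ← hu] at h1
      have h2 : ∑ σ, M.prob σ * Function.update r s ρ σ =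
          ∑ σ, M.prob σ * r σ + M.prob s * (ρ - r s) := by
        rw [← sub_eq_iff_eq_add', ← Finset.sum_sub_distrib, Finset.sum_eq_single s]
        · simp [mul_sub]
        · intro σ _ hσ
          simp [hσ]
        · simp
      rw [h2] at h1
      have h3 : M.prob s * ⟪u s, v - x s⟫_ℝ ≤ M.prob s * (ρ - r s) := by linarith
      have h4 := le_of_mul_le_mul_left h3 (hprob s)
      linarith
    · rcases eq_or_ne σ s with rfl | hσ
      · simpa using hv
      · simp [hσ, hr]

theorem isSolution_of_multiplier (hprob : ∀ s, 0 < M.prob s) (hbot : ∀ s x, M.cost s x ≠ ⊥)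
    {x u : FullVar S n} (hx : x ∈ M.nonanticipative)
    (hu : ∀ w ∈ M.nonanticipative, ∑ s, M.prob s * ⟪u s, w s⟫_ℝ = 0)
    (hsub : ∀ s, IsSubgradientAt (M.cost s) (u s) (x s)) : M.IsSolution x := by
  choose r hr hle using hsub
  refine ⟨hx, fun w hw => ?_⟩
  change M.objective x ≤ M.objective w
  by_cases hfin : M.objective w < ⊤
  · obtain ⟨ρ, hρ⟩ := exists_cost_eq_coe hprob hbot hfin
    rw [objective_eq_coe hr, objective_eq_coe hρ, EReal.coe_le_coe_iff]
    have h0 := hu (w - x) (M.nonanticipative.sub_mem hw hx)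
    have h1 : ∑ s, (M.prob s * r s + M.prob s * ⟪u s, (w - x) s⟫_ℝ) ≤ ∑ s, M.prob s * ρ s := by
      refine Finset.sum_le_sum fun s _ => ?_
      rw [← mul_add]
      exact mul_le_mul_of_nonneg_left (hle s _ _ (hρ s).le) (hprob s).le
    rwa [Finset.sum_add_distrib, h0, add_zero] at h1
  · rw [not_lt_top_iff.1 hfin]
    exact le_top

/-! ### Bundle averaging as a weighted orthogonal projection -/

lemma mem_bundle {s σ : Fin S} {t : Fin T} : σ ∈ M.bundle s t ↔ M.SameHistory t s σ := by
  simp [bundle]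

lemma SameHistory.symm {t : Fin T} {s σ : Fin S} (h : M.SameHistory t s σ) :
    M.SameHistory t σ s := fun τ hτ => (h τ hτ).symm

lemma SameHistory.trans {t : Fin T} {s σ τ : Fin S} (h : M.SameHistory t s σ)
    (h' : M.SameHistory t σ τ) : M.SameHistory t s τ := fun i hi => (h i hi).trans (h' i hi)

lemma SameHistory.bundle_eq {t : Fin T} {s σ : Fin S} (h : M.SameHistory t s σ) :
    M.bundle s t = M.bundle σ t := by
  ext τ
  rw [mem_bundle, mem_bundle]
  exact ⟨h.symm.trans, h.trans⟩

lemma bundleAvg_apply (z : FullVar S n) (s : Fin S) (t : Fin T) :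
    M.bundleAvg z s t =
      (∑ σ ∈ M.bundle s t, M.prob σ)⁻¹ • ∑ σ ∈ M.bundle s t, M.prob σ • z σ t := rfl

lemma bundleAvg_mem (z : FullVar S n) : M.bundleAvg z ∈ M.nonanticipative := by
  intro t s σ h
  rw [bundleAvg_apply, bundleAvg_apply, h.bundle_eq]

lemma sum_prob_bundle_pos (hprob : ∀ s, 0 < M.prob s) (s : Fin S) (t : Fin T) :
    0 < ∑ σ ∈ M.bundle s t, M.prob σ :=
  Finset.sum_pos (fun σ _ => hprob σ) ⟨s, mem_bundle.2 fun _ _ => rfl⟩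

/-- The bundle average is self-adjoint relative to the nonanticipative subspace. -/
lemma sum_inner_bundleAvg (hprob : ∀ s, 0 < M.prob s) (z : FullVar S n) {w : FullVar S n}
    (hw : w ∈ M.nonanticipative) :
    ∑ s, M.prob s * ⟪M.bundleAvg z s, w s⟫_ℝ = ∑ s, M.prob s * ⟪z s, w s⟫_ℝ := by
  have hinner : ∀ x y : Decision n, ⟪x, y⟫_ℝ = ∑ t, ⟪x t, y t⟫_ℝ := PiLp.inner_apply
  simp only [hinner, Finset.mul_sum]
  rw [Finset.sum_comm, Finset.sum_comm (s := Finset.univ) (t := Finset.univ)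
    (f := fun s t => M.prob s * ⟪z s t, w s t⟫_ℝ)]
  refine Finset.sum_congr rfl fun t _ => ?_
  calc ∑ s, M.prob s * ⟪M.bundleAvg z s t, w s t⟫_ℝ
      = ∑ s, ∑ σ ∈ M.bundle s t, M.prob s * ((∑ τ ∈ M.bundle σ t, M.prob τ)⁻¹ *
          (M.prob σ * ⟪z σ t, w σ t⟫_ℝ)) := by
        refine Finset.sum_congr rfl fun s _ => ?_
        rw [bundleAvg_apply, real_inner_smul_left, sum_inner, Finset.mul_sum, Finset.mul_sum]
        refine Finset.sum_congr rfl fun σ hσ => ?_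
        rw [real_inner_smul_left, (mem_bundle.1 hσ).bundle_eq, hw t s σ (mem_bundle.1 hσ)]
    _ = ∑ σ, ∑ s ∈ M.bundle σ t, M.prob s * ((∑ τ ∈ M.bundle σ t, M.prob τ)⁻¹ *
          (M.prob σ * ⟪z σ t, w σ t⟫_ℝ)) := by
        refine Finset.sum_comm' fun s σ => ?_
        simp only [Finset.mem_univ, true_and, and_true, mem_bundle]
        exact ⟨SameHistory.symm, SameHistory.symm⟩
    _ = ∑ σ, M.prob σ * ⟪z σ t, w σ t⟫_ℝ := by
        refine Finset.sum_congr rfl fun σ _ => ?_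
        rw [← Finset.sum_mul, mul_inv_cancel_left₀ (sum_prob_bundle_pos hprob σ t).ne']

lemma sum_inner_sub_bundleAvg (hprob : ∀ s, 0 < M.prob s) (z : FullVar S n) {w : FullVar S n}
    (hw : w ∈ M.nonanticipative) :
    ∑ s, M.prob s * ⟪z s - M.bundleAvg z s, w s⟫_ℝ = 0 := by
  simp only [inner_sub_left, mul_sub, Finset.sum_sub_distrib]
  rw [sum_inner_bundleAvg hprob z hw, sub_self]

/-- Uniqueness of the orthogonal projection: the difference of the two candidates lies in the
subspace and is orthogonal to it. -/
lemma bundleAvg_eq_of_forall (hprob : ∀ s, 0 < M.prob s) {z x : FullVar S n}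
    (hx : x ∈ M.nonanticipative)
    (h : ∀ w ∈ M.nonanticipative, ∑ s, M.prob s * ⟪z s - x s, w s⟫_ℝ = 0) :
    M.bundleAvg z = x := by
  have hmem : M.bundleAvg z - x ∈ M.nonanticipative :=
    M.nonanticipative.sub_mem (bundleAvg_mem z) hx
  have h1 := h _ hmem
  have h2 := sum_inner_sub_bundleAvg hprob z hmem
  have h3 : ∑ s, M.prob s * ‖(M.bundleAvg z - x) s‖ ^ 2 = 0 := by
    rw [← sub_eq_zero.2 (h1.trans h2.symm), ← Finset.sum_sub_distrib]
    refine Finset.sum_congr rfl fun s _ => ?_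
    rw [← mul_sub, ← inner_sub_left, sub_sub_sub_cancel_left, ← real_inner_self_eq_norm_sq]
    rfl
  rw [Finset.sum_eq_zero_iff_of_nonneg fun s _ =>
    mul_nonneg (hprob s).le (sq_nonneg _)] at h3
  funext s
  have := h3 s (Finset.mem_univ s)
  simpa [(hprob s).ne', sub_eq_zero] using this

lemma continuous_bundleAvg (s : Fin S) : Continuous fun z => M.bundleAvg z s := by
  refine (PiLp.continuous_toLp 2 _).comp (continuous_pi fun t => ?_)
  have h : ∀ σ, Continuous fun z : FullVar S n => z σ t := fun σ =>
    (PiLp.continuous_apply 2 _ t).comp (continuous_apply σ)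
  have hsum : Continuous fun z : FullVar S n => ∑ σ ∈ M.bundle s t, M.prob σ • z σ t :=
    continuous_finsetSum _ fun σ _ => (h σ).const_smul (M.prob σ)
  exact hsum.const_smul (∑ σ ∈ M.bundle s t, M.prob σ)⁻¹

end MultistageProblem

/-! ### The Douglas–Rachford operator, its fixed points and its descent -/

/-- The right side minus the left is exactly twice the inner product in `h`. It is applied to
differences of states, averages and proximal points. -/
lemma norm_sq_add_norm_sq_le_of_inner_nonneg {E : Type*} [NormedAddCommGroup E]
    [InnerProductSpace ℝ E] (z x y : E) (h : 0 ≤ ⟪((2 : ℝ) • x - z) - y, y⟫_ℝ) :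
    ‖z + y - x‖ ^ 2 + ‖y - x‖ ^ 2 ≤ ‖z‖ ^ 2 - 2 * ⟪z - x, x⟫_ℝ := by
  simp only [← real_inner_self_eq_norm_sq, inner_sub_left, inner_sub_right, inner_add_left,
    inner_add_right, real_inner_smul_left] at h ⊢
  linarith [real_inner_comm x z, real_inner_comm x y, real_inner_comm y z]

namespace MultistageProblem

variable {S T : ℕ} {n : Fin T → ℕ} {Ξ : Fin (T - 1) → Type*} (M : MultistageProblem S T n Ξ)

/-- The Douglas–Rachford operator, of which a step of Randomized Progressive Hedging updates one
row. -/
def douglasRachford (mu : ℝ) (z : FullVar S n) : FullVar S n := fun s =>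
  z s + proxPoint (M.cost s) mu ((2 : ℝ) • M.bundleAvg z s - z s) - M.bundleAvg z s

variable {M}

lemma subproblem_eq (mu : ℝ) (z : FullVar S n) (s : Fin S) :
    M.subproblem mu z s = proxObjective (M.cost s) mu ((2 : ℝ) • M.bundleAvg z s - z s) := by
  funext y
  rw [subproblem, proxObjective, sub_add]

lemma rphStep_eq (mu : ℝ) (z : FullVar S n) (s : Fin S) :
    M.rphStep mu z s = Function.update z s (M.douglasRachford mu z s) := by
  rw [rphStep, subproblem_eq]
  rfl

lemma proxPoint_of_isFixedPt {mu : ℝ} {z : FullVar S n} (hz : M.douglasRachford mu z = z) (s : Fin S) :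
    proxPoint (M.cost s) mu ((2 : ℝ) • M.bundleAvg z s - z s) = M.bundleAvg z s := by
  have h := congrFun hz s
  rw [douglasRachford, add_sub_assoc, add_eq_left, sub_eq_zero] at h
  exact h

variable (hprob : ∀ s, 0 < M.prob s) (hconvex : ∀ s, ConvexEReal (M.cost s))
  (hproper : ∀ s, ProperEReal (M.cost s)) (hlsc : ∀ s, LowerSemicontinuous (M.cost s))
  {mu : ℝ} (hmu : 0 < mu)

include hconvex hproper hlsc hmu

lemma continuous_douglasRachford : Continuous (M.douglasRachford mu) := by
  refine continuous_pi fun s => ?_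
  have h1 := continuous_bundleAvg (M := M) s
  have h2 := continuous_proxPoint (hconvex s) (hproper s) (hlsc s) hmu
  have h3 : Continuous fun z : FullVar S n => z s := continuous_apply s
  exact (h3.add (h2.comp ((h1.const_smul (2 : ℝ)).sub h3))).sub h1

include hprob

theorem isSolution_bundleAvg_of_isFixedPt {z : FullVar S n} (hz : M.douglasRachford mu z = z) :
    M.IsSolution (M.bundleAvg z) := by
  refine isSolution_of_multiplier hprob (fun s => (hproper s).1)
    (u := fun s => mu⁻¹ • (M.bundleAvg z s - z s)) (bundleAvg_mem z) (fun w hw => ?_) fun s => ?_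
  · have h := sum_inner_sub_bundleAvg hprob z hw
    have h1 : ∀ s, M.prob s * ⟪mu⁻¹ • (M.bundleAvg z s - z s), w s⟫_ℝ =
        -mu⁻¹ * (M.prob s * ⟪z s - M.bundleAvg z s, w s⟫_ℝ) := fun s => by
      rw [real_inner_smul_left, ← neg_sub (z s), inner_neg_left]
      ring
    simp only [h1, ← Finset.mul_sum, h, mul_zero]
  · have h := isSubgradientAt_proxPoint (hconvex s) (hproper s) (hlsc s) hmu
      ((2 : ℝ) • M.bundleAvg z s - z s)
    rw [proxPoint_of_isFixedPt hz s] at h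
    convert h using 2
    module

/-- For z = x - μu, orthogonality of `u` gives Πz = x. Then 2Πz - z = x + μu, whose proximal point
is `x` because `u` is a subgradient there. -/
theorem exists_isFixedPt
    (hri : ((M.nonanticipative : Set (FullVar S n)) ∩ intrinsicInterior ℝ M.domain).Nonempty)
    {x : FullVar S n} (hx : M.IsSolution x) : ∃ z, M.douglasRachford mu z = z := by
  obtain ⟨u, hu, hsub⟩ := exists_multiplier hprob hconvex (fun s => (hproper s).1) hri hx
  refine ⟨x - mu • u, ?_⟩
  have havg : M.bundleAvg (x - mu • u) = x := by
    refine bundleAvg_eq_of_forall hprob hx.1 fun w hw => ?_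
    have h1 : ∀ s, M.prob s * ⟪(x - mu • u) s - x s, w s⟫_ℝ =
        -mu * (M.prob s * ⟪u s, w s⟫_ℝ) := fun s => by
      rw [Pi.sub_apply, Pi.smul_apply, sub_sub_cancel_left, inner_neg_left, real_inner_smul_left]
      ring
    simp only [h1, ← Finset.mul_sum, hu w hw, mul_zero]
  funext s
  rw [douglasRachford, havg, proxPoint_eq (y := x s) (hconvex s) (hproper s) (hlsc s) hmu,
    add_sub_cancel_right]
  convert hsub s using 1
  rw [inv_smul_eq_iff₀ hmu.ne', Pi.sub_apply, Pi.smul_apply]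
  module

/-- Each row obeys the firm nonexpansiveness estimate up to a cross term of no definite sign. The
cross terms vanish only after the weighted sum over scenarios, by orthogonality of the projection.
-/
theorem douglasRachford_descent {z z' : FullVar S n} (hz' : M.douglasRachford mu z' = z') :
    ∑ s, M.prob s * ‖M.douglasRachford mu z s - z' s‖ ^ 2 +
      ∑ s, M.prob s * ‖M.douglasRachford mu z s - z s‖ ^ 2 ≤
    ∑ s, M.prob s * ‖z s - z' s‖ ^ 2 := by
  have hmem : M.bundleAvg z - M.bundleAvg z' ∈ M.nonanticipative :=
    M.nonanticipative.sub_mem (bundleAvg_mem z) (bundleAvg_mem z')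
  have horth : ∑ s, M.prob s * ⟪(z s - z' s) - (M.bundleAvg z s - M.bundleAvg z' s),
      M.bundleAvg z s - M.bundleAvg z' s⟫_ℝ = 0 := by
    have h1 := sum_inner_sub_bundleAvg hprob z hmem
    have h2 := sum_inner_sub_bundleAvg hprob z' hmem
    rw [← sub_eq_zero.2 (h1.trans h2.symm), ← Finset.sum_sub_distrib]
    refine Finset.sum_congr rfl fun s _ => ?_
    rw [← mul_sub, ← inner_sub_left, sub_sub_sub_comm]
    rfl
  have hrow : ∀ s, M.prob s * ‖M.douglasRachford mu z s - z' s‖ ^ 2 +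
      M.prob s * ‖M.douglasRachford mu z s - z s‖ ^ 2 ≤ M.prob s * ‖z s - z' s‖ ^ 2 -
        2 * (M.prob s * ⟪(z s - z' s) - (M.bundleAvg z s - M.bundleAvg z' s),
          M.bundleAvg z s - M.bundleAvg z' s⟫_ℝ) := fun s => by
    have hfix := proxPoint_of_isFixedPt hz' s
    have h1 := inner_proxPoint_sub_nonneg (hconvex s) (hproper s) (hlsc s) hmu
      ((2 : ℝ) • M.bundleAvg z s - z s) ((2 : ℝ) • M.bundleAvg z' s - z' s)
    rw [hfix] at h1
    set y := proxPoint (M.cost s) mu ((2 : ℝ) • M.bundleAvg z s - z s) with hy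
    have h2 := norm_sq_add_norm_sq_le_of_inner_nonneg (z s - z' s)
      (M.bundleAvg z s - M.bundleAvg z' s) (y - M.bundleAvg z' s) (by
        convert h1 using 3
        module)
    have h3 : M.douglasRachford mu z s - z' s = (z s - z' s) + (y - M.bundleAvg z' s) -
        (M.bundleAvg z s - M.bundleAvg z' s) := by
      rw [douglasRachford, ← hy]
      abel
    have h4 : M.douglasRachford mu z s - z s = (y - M.bundleAvg z' s) -
        (M.bundleAvg z s - M.bundleAvg z' s) := by
      rw [douglasRachford, ← hy]
      abel
    rw [← h3, ← h4] at h2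
    have h5 := mul_le_mul_of_nonneg_left h2 (hprob s).le
    linarith
  have hsum := Finset.sum_le_sum fun s (_ : s ∈ Finset.univ) => hrow s
  rwa [Finset.sum_add_distrib, Finset.sum_sub_distrib, ← Finset.mul_sum, horth, mul_zero,
    sub_zero] at hsum

/-! ### Expected decrease of the weighted distance, and convergence -/

omit hconvex hproper hlsc hmu

/-- The weighted squared distance that decreases in expectation along the iteration. -/
def weightedSqDist (M : MultistageProblem S T n Ξ) (q : Fin S → ℝ) (z z' : FullVar S n) : ℝ :=
  ∑ s, M.prob s / q s * ‖z s - z' s‖ ^ 2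

omit hprob in
lemma weightedSqDist_update (q : Fin S → ℝ) (z z' : FullVar S n) (s : Fin S) (v : Decision n) :
    M.weightedSqDist q (Function.update z s v) z' = M.weightedSqDist q z z' +
      M.prob s / q s * (‖v - z' s‖ ^ 2 - ‖z s - z' s‖ ^ 2) := by
  rw [← sub_eq_iff_eq_add', weightedSqDist, weightedSqDist, ← Finset.sum_sub_distrib,
    Finset.sum_eq_single s]
  · simp [mul_sub]
  · intro σ _ hσ
    simp [hσ]
  · simp

include hconvex hproper hlsc hmu

/-- Drawing `s` changes the distance only through row `s`, with weight p_s/q_s. Averaging with `q s`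
leaves p_s, so the expected change is that of a full Douglas–Rachford step. -/
lemma sum_weightedSqDist_rphStep_le {q : Fin S → ℝ} (hq : ∀ s, 0 < q s) (hqsum : ∑ s, q s = 1)
    {z' : FullVar S n} (hz' : M.douglasRachford mu z' = z') (z : FullVar S n) :
    ∑ s, q s * M.weightedSqDist q (M.rphStep mu z s) z' ≤ M.weightedSqDist q z z' -
      ∑ s, M.prob s * ‖M.douglasRachford mu z s - z s‖ ^ 2 := by
  have h := douglasRachford_descent hprob hconvex hproper hlsc hmu (z := z) hz'
  have h1 : ∀ s, q s * M.weightedSqDist q (M.rphStep mu z s) z' =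
      q s * M.weightedSqDist q z z' + (M.prob s * ‖M.douglasRachford mu z s - z' s‖ ^ 2 -
        M.prob s * ‖z s - z' s‖ ^ 2) := fun s => by
    rw [rphStep_eq, weightedSqDist_update]
    have := (hq s).ne'
    field_simp
  simp only [h1]
  rw [Finset.sum_add_distrib, ← Finset.sum_mul, hqsum, one_mul, Finset.sum_sub_distrib]
  linarith

omit hconvex hproper hlsc hmu

/-- Rescaling of the rows that turns the weighted distance into the Euclidean one. -/
def rescale (M : MultistageProblem S T n Ξ) (q : Fin S → ℝ) (z : FullVar S n) :
    PiLp 2 (fun _ : Fin S => Decision n) :=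
  WithLp.toLp 2 fun s => √(M.prob s / q s) • z s

/-- `FullVar` carries the supremum distance, whereas the quantity that converges is the weighted
one; Opial's argument therefore runs in the rescaled space. -/
lemma dist_rescale {q : Fin S → ℝ} (hq : ∀ s, 0 < q s) (z z' : FullVar S n) :
    dist (M.rescale q z) (M.rescale q z') = √(M.weightedSqDist q z z') := by
  rw [PiLp.dist_eq_of_L2, weightedSqDist]
  congr 1
  refine Finset.sum_congr rfl fun s _ => ?_
  simp only [rescale]
  rw [dist_eq_norm, ← smul_sub, norm_smul, mul_pow, Real.norm_eq_abs, sq_abs,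
    Real.sq_sqrt (div_pos (hprob s) (hq s)).le]

/-- Inverse of `rescale`. -/
def unscale (M : MultistageProblem S T n Ξ) (q : Fin S → ℝ)
    (a : PiLp 2 (fun _ : Fin S => Decision n)) : FullVar S n :=
  fun s => (√(M.prob s / q s))⁻¹ • a s

lemma unscale_rescale {q : Fin S → ℝ} (hq : ∀ s, 0 < q s) (z : FullVar S n) :
    M.unscale q (M.rescale q z) = z := by
  funext s
  exact inv_smul_smul₀ (Real.sqrt_pos.2 (div_pos (hprob s) (hq s))).ne' _

lemma rescale_unscale {q : Fin S → ℝ} (hq : ∀ s, 0 < q s)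
    (a : PiLp 2 (fun _ : Fin S => Decision n)) : M.rescale q (M.unscale q a) = a := by
  ext1 s
  exact smul_inv_smul₀ (Real.sqrt_pos.2 (div_pos (hprob s) (hq s))).ne' _

omit hprob in
lemma continuous_unscale (q : Fin S → ℝ) : Continuous (M.unscale q) :=
  continuous_pi fun s => by
    have h : Continuous fun a : PiLp 2 (fun _ : Fin S => Decision n) => a s :=
      PiLp.continuous_apply 2 _ s
    exact h.const_smul (√(M.prob s / q s))⁻¹

include hconvex hproper hlsc hmu

theorem exists_tendsto_isFixedPt {q : Fin S → ℝ} (hq : ∀ s, 0 < q s)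
    {D : Set (PiLp 2 (fun _ : Fin S => Decision n))} (hDne : D.Nonempty)
    (hDdense : M.rescale q '' {z | M.douglasRachford mu z = z} ⊆ closure D) {z : ℕ → FullVar S n}
    (hdist : ∀ a ∈ D,
      ∃ c, Tendsto (fun k => M.weightedSqDist q (z k) (M.unscale q a)) atTop (𝓝 c))
    (hres : Tendsto (fun k => ∑ s, M.prob s * ‖M.douglasRachford mu (z k) s - z k s‖ ^ 2)
      atTop (𝓝 0)) :
    ∃ z', M.douglasRachford mu z' = z' ∧ Tendsto z atTop (𝓝 z') := by
  obtain ⟨_, ⟨z', hz', rfl⟩, hlim⟩ := exists_tendsto_of_dist_tendsto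
    (x := fun k => M.rescale q (z k)) hDne hDdense (fun a ha => by
      obtain ⟨c, hc⟩ := hdist a ha
      refine ⟨√c, (hc.sqrt).congr fun k => ?_⟩
      rw [← dist_rescale hprob hq, rescale_unscale hprob hq])
    -- The residual is continuous and tends to 0, so it vanishes at every cluster point, which is
    -- therefore a fixed point.
    (fun a φ hφ ha => by
      have hlim : Tendsto (fun k => z (φ k)) atTop (𝓝 (M.unscale q a)) := by
        refine (((continuous_unscale q).tendsto a).comp ha).congr fun k => ?_
        exact unscale_rescale hprob hq _
      have hcont : Continuous fun z : FullVar S n =>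
          ∑ s, M.prob s * ‖M.douglasRachford mu z s - z s‖ ^ 2 := by
        have hT := continuous_douglasRachford hconvex hproper hlsc hmu
        refine continuous_finsetSum _ fun s _ => ?_
        exact ((((continuous_apply s).comp hT).sub (continuous_apply s)).norm.pow 2).const_mul _
      have hzero := tendsto_nhds_unique ((hcont.tendsto _).comp hlim)
        (hres.comp hφ.tendsto_atTop)
      rw [Finset.sum_eq_zero_iff_of_nonneg fun s _ =>
        mul_nonneg (hprob s).le (sq_nonneg _)] at hzero
      refine ⟨M.unscale q a, funext fun s => ?_, rescale_unscale hprob hq a⟩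
      have := hzero s (Finset.mem_univ s)
      simpa [(hprob s).ne', sub_eq_zero] using this)
  refine ⟨z', hz', ?_⟩
  have := ((continuous_unscale (M := M) q).tendsto _).comp hlim
  rw [unscale_rescale hprob hq] at this
  exact this.congr fun k => unscale_rescale hprob hq _

end MultistageProblem
end

/-! ### Assembly of the convergence theorem -/

theorem theorem2 {S T : ℕ} {n : Fin T → ℕ} {Ξ : Fin (T - 1) → Type*}
    (M : MultistageProblem S T n Ξ)
    (hprob : ∀ s, 0 < M.prob s)
    (hconvex : ∀ s, ConvexEReal (M.cost s))
    (hproper : ∀ s, ProperEReal (M.cost s))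
    (hlsc : ∀ s, LowerSemicontinuous (M.cost s))
    (hsol : ∃ x, M.IsSolution x)
    (hri : ((M.nonanticipative : Set (FullVar S n)) ∩ intrinsicInterior ℝ M.domain).Nonempty)
    (mu : ℝ) (hmu : 0 < mu)
    (z₀ : FullVar S n) (hz₀ : z₀ ∈ M.nonanticipative)
    (q : Fin S → ℝ) (hq : ∀ s, 0 < q s)
    {Ω : Type*} [MeasurableSpace Ω] (Pr : Measure Ω) [IsProbabilityMeasure Pr]
    (draw : ℕ → Ω → Fin S)
    (hmeas : ∀ k, Measurable (draw k))
    (hindep : iIndepFun draw Pr)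
    (hlaw : ∀ k s, Pr.real {ω | draw k ω = s} = q s) :
    (∀ (z : FullVar S n) (s : Fin S), ∃! y, IsMinOn (M.subproblem mu z s) Set.univ y) ∧
    (∀ᵐ ω ∂Pr, ∀ k, M.rphOutput mu z₀ (fun j => draw j ω) k ∈ M.nonanticipative) ∧
    (∀ᵐ ω ∂Pr, ∃ x, M.IsSolution x ∧
      Tendsto (fun k => M.rphOutput mu z₀ (fun j => draw j ω) k) atTop (𝓝 x)) := by

  have hqsum : ∑ s, q s = 1 := by
    have h := sum_measureReal_preimage_singleton (μ := Pr) (f := draw 0) Finset.univ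
      (fun s _ => hmeas 0 (measurableSet_singleton s))
    simp only [Finset.coe_univ, Set.preimage_univ, probReal_univ] at h
    rw [← h]
    exact Finset.sum_congr rfl fun s _ => (hlaw 0 s).symm
  refine ⟨fun z s => ?_, ae_of_all _ fun ω k => MultistageProblem.bundleAvg_mem _, ?_⟩
  · rw [MultistageProblem.subproblem_eq]
    exact existsUnique_isMinOn_proxObjective (hconvex s) (hproper s) (hlsc s) hmu _
  obtain ⟨x, hx⟩ := hsol
  obtain ⟨zfix, hzfix⟩ :=
    MultistageProblem.exists_isFixedPt hprob hconvex hproper hlsc hmu hri hx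
  -- The exceptional null set depends on the fixed point; a countable dense family makes a single
  -- one suffice.
  obtain ⟨D, hDsub, hDcount, hDdense⟩ := (TopologicalSpace.IsSeparable.of_separableSpace
    (M.rescale q '' {z | M.douglasRachford mu z = z})).exists_countable_dense_subset
  have hDne : D.Nonempty := by
    rw [← closure_nonempty_iff]
    exact ⟨_, hDdense ⟨zfix, hzfix, rfl⟩⟩
  have hDfix : ∀ a ∈ D, M.douglasRachford mu (M.unscale q a) = M.unscale q a := by
    intro a ha
    obtain ⟨z, hz, rfl⟩ := hDsub ha
    rw [MultistageProblem.unscale_rescale hprob hq]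
    exact hz
  have hlyap : ∀ a ∈ D, ∀ᵐ ω ∂Pr,
      (∃ c, Tendsto (fun k => M.weightedSqDist q (M.rphIterate mu z₀ (fun j => draw j ω) k)
        (M.unscale q a)) atTop (𝓝 c)) ∧
      Tendsto (fun k => ∑ s, M.prob s *
        ‖M.douglasRachford mu (M.rphIterate mu z₀ (fun j => draw j ω) k) s -
          M.rphIterate mu z₀ (fun j => draw j ω) k s‖ ^ 2) atTop (𝓝 0) := fun a ha =>
    ae_tendsto_of_recursion (g := M.rphStep mu) (x₀ := z₀)
      (x := fun k ω => M.rphIterate mu z₀ (fun j => draw j ω) k)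
      (V := fun z => M.weightedSqDist q z (M.unscale q a))
      (D := fun z => ∑ s, M.prob s * ‖M.douglasRachford mu z s - z s‖ ^ 2)
      hmeas hindep hlaw (fun _ => rfl) (fun _ _ => rfl)
      (fun z => Finset.sum_nonneg fun s _ =>
        mul_nonneg (div_pos (hprob s) (hq s)).le (sq_nonneg _))
      (fun z => Finset.sum_nonneg fun s _ => mul_nonneg (hprob s).le (sq_nonneg _))
      (MultistageProblem.sum_weightedSqDist_rphStep_le hprob hconvex hproper hlsc hmu hq hqsum
        (hDfix a ha))
  filter_upwards [(ae_ball_iff hDcount).2 hlyap] with ω hω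
  obtain ⟨a, ha⟩ := hDne
  obtain ⟨z, hz, hlim⟩ := MultistageProblem.exists_tendsto_isFixedPt hprob hconvex hproper hlsc
    hmu hq ⟨a, ha⟩ hDdense (fun a ha => (hω a ha).1) (hω a ha).2
  refine ⟨M.bundleAvg z,
    MultistageProblem.isSolution_bundleAvg_of_isFixedPt hprob hconvex hproper hlsc hmu hz, ?_⟩
  exact tendsto_pi_nhds.2 fun s =>
    ((MultistageProblem.continuous_bundleAvg s).tendsto z).comp hlim
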